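/- A Diophantine $n$-gon ($n\ge 3$) is a simple polygon in the Euclidean plane with $n$ vertices, no three of which lie on one straight line, such that the length of every side and of every diagonal is a natural number. It is called concave if it is not convex. Suppose that some side or diagonal of a Diophantine $n$-gon has length $2$. If the $n$-gon is convex, then $n\le 5$, that is, $n\in\{3,4,5\}$; if it is concave, then $n\le 6$. -/

import Mathlib

namespace Polygon

/-- A closed polygon in the Euclidean plane is *simple* if its vertices are pairwise distinct and
two different sides meet at most in a common endpoint. -/
def IsSimple {n : ℕ} (P : Polygon (EuclideanSpace ℝ (Fin 2)) n) : Prop :=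
  Function.Injective P.vertices ∧
    ∀ i j : Fin n, i ≠ j →
      P.edgeSet ℝ i ∩ P.edgeSet ℝ j ⊆
        ({P i, P (finRotate n i)} ∩ {P j, P (finRotate n j)} : Set (EuclideanSpace ℝ (Fin 2)))

/-- A simple polygon is *convex* if, for each side, all the vertices lie in one closed half-plane
bounded by the line through that side. -/
def IsConvex {n : ℕ} (P : Polygon (EuclideanSpace ℝ (Fin 2)) n) : Prop :=
  P.IsSimple ∧
    ∀ i j k : Fin n,
      (affineSpan ℝ {P i, P (finRotate n i)}).WSameSide (P j) (P k)

/-- A *concave* polygon is a simple polygon that is not convex. -/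
def IsConcave {n : ℕ} (P : Polygon (EuclideanSpace ℝ (Fin 2)) n) : Prop :=
  P.IsSimple ∧ ¬ P.IsConvex

/-- A *Diophantine `n`-gon*: a simple plane polygon with `n ≥ 3` vertices, no three of them
on one straight line, all of whose sides and diagonals have lengths in `ℕ`. -/
structure IsDiophantine {n : ℕ} (P : Polygon (EuclideanSpace ℝ (Fin 2)) n) : Prop where
  three_le : 3 ≤ n
  isSimple : P.IsSimple
  not_collinear : ∀ i j k : Fin n, i ≠ j → j ≠ k → i ≠ k →
    ¬ Collinear ℝ ({P i, P j, P k} : Set (EuclideanSpace ℝ (Fin 2)))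
  dist_nat : ∀ i j : Fin n, ∃ m : ℕ, dist (P i) (P j) = m

end Polygon

/-! Let `AB` be the segment of length 2. A further vertex at integral distances `a`, `b` from `A`,
`B` is off the line `AB`, so `|a - b| < 2`: it lies on the bisector or on the hyperbola `|a - b| =
1`. In coordinates `(X, K)`, four times the Cartesian ones, the hyperbola is `K ^ 2 = 3 * X ^ 2 -
12` with `X` odd. The bisector holds at most one such vertex (`eq_zero_of_bisector_relation`), and
so does each of the two pairs of opposite arms, told apart by the sign of `X * K`
(`eq_zero_of_hyperbola_relation`). Hence `n - 2 ≤ 3`, convex or not. -/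

/-- Arithmetic core: the relation between two points of the hyperbola forces even distances. -/
theorem even_of_hyperbola_relation {X Y δ d : ℤ} (hY : Odd Y) (hδ : X = Y + 2 * δ)
    (h : 4 * (d ^ 2 - δ ^ 2) ^ 2 - 3 * (X * Y - 4) * (d ^ 2 - δ ^ 2) + 9 * δ ^ 2 = 0) :
    Even δ ∧ Even d := by
  subst hδ
  -- As `Y` is odd, `Y ^ 2 = 1` modulo 8, which leaves a finite check; `4 * z = 0` in `ZMod 8`
  -- encodes evenness of `z`.
  have key : ∀ y t e : ZMod 8, y * y = 1 →
      4 * (e ^ 2 - t ^ 2) ^ 2 - 3 * ((y + 2 * t) * y - 4) * (e ^ 2 - t ^ 2) + 9 * t ^ 2 = 0 →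
      4 * t = 0 ∧ 4 * e = 0 := by decide
  have h1 : ((Y : ZMod 8)) * Y = 1 := by
    have h8 : (Y * Y - 1) % 8 = 0 := by
      obtain ⟨k, rfl⟩ := hY
      have : Even (k * (k + 1)) := Int.even_mul_succ_self k
      obtain ⟨r, hr⟩ := this
      have : (2 * k + 1) * (2 * k + 1) - 1 = 8 * r := by linarith
      omega
    have := (ZMod.intCast_zmod_eq_zero_iff_dvd (Y * Y - 1) 8).2 (Int.dvd_of_emod_eq_zero h8)
    push_cast at this
    exact sub_eq_zero.1 this
  have h2 := congrArg (Int.cast : ℤ → ZMod 8) h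
  push_cast at h2
  obtain ⟨ht, he⟩ := key Y δ d h1 h2
  have aux : ∀ z : ℤ, (4 * (z : ZMod 8)) = 0 → Even z := by
    intro z hz
    have : ((4 * z : ℤ) : ZMod 8) = 0 := by push_cast; exact hz
    have := (ZMod.intCast_zmod_eq_zero_iff_dvd (4 * z) 8).1 this
    rw [Int.even_iff]
    omega
  exact ⟨aux δ ht, aux d he⟩

theorem add_two_le_of_even {a b : ℤ} (ha : Even a) (hb : Even b) (h : a < b) : a + 2 ≤ b := by
  obtain ⟨r, hr⟩ := ha
  obtain ⟨s, hs⟩ := hb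
  omega

/-- With `E = d ^ 2 - D ^ 2` and `q = x * y - 4`, `hs` selects the smaller root of the quadratic in
`E`, so `E * q ≤ 6 * D ^ 2`. If `D < d`, evenness makes `E ≥ 4 * D + 4`, too large since `q ≥ 6 * D
+ 5`. -/
theorem eq_zero_of_same_branch {x y D d : ℤ} (hx : 3 ≤ x) (hy : 3 ≤ y) (hD : 0 ≤ D) (hd : 0 ≤ d)
    (hDe : Even D) (hde : Even d) (hxy : 4 * D ^ 2 = (x - y) ^ 2)
    (hrel : 4 * (d ^ 2 - D ^ 2) ^ 2 - 3 * (x * y - 4) * (d ^ 2 - D ^ 2) + 9 * D ^ 2 = 0)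
    (hs : 8 * (d ^ 2 - D ^ 2) < 3 * (x * y - 4)) : d = 0 := by
  have hq : 5 + 6 * D ≤ x * y - 4 := by
    have h1 : (2 * D) ^ 2 = |x - y| ^ 2 := by rw [sq_abs]; linarith
    have h2 : 2 * D = |x - y| := (pow_left_inj₀ (by positivity) (abs_nonneg _) two_ne_zero).1 h1
    rcases abs_cases (x - y) with ⟨h3, h4⟩ | ⟨h3, h4⟩
    · obtain rfl : x = y + 2 * D := by linarith
      nlinarith [mul_nonneg (sub_nonneg.2 hy) hD]
    · obtain rfl : y = x + 2 * D := by linarith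
      nlinarith [mul_nonneg (sub_nonneg.2 hx) hD]
  have hE0 : 0 ≤ d ^ 2 - D ^ 2 := by
    by_contra hc
    push Not at hc
    have : 0 < (x * y - 4) * -(d ^ 2 - D ^ 2) := mul_pos (by linarith) (by linarith)
    linarith [sq_nonneg (d ^ 2 - D ^ 2), sq_nonneg D]
  have hle : D ≤ d := (sq_le_sq₀ hD hd).1 (by linarith)
  rcases hle.eq_or_lt with rfl | hlt
  · have : D ^ 2 = 0 := by
      rw [sub_self] at hrel
      linarith
    exact (pow_eq_zero_iff two_ne_zero).1 this
  exfalso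
  have hdl := add_two_le_of_even hDe hde hlt
  have hE4 : 4 * D + 4 ≤ d ^ 2 - D ^ 2 := by
    have : (D + 2) ^ 2 ≤ d ^ 2 := by gcongr
    linarith
  generalize d ^ 2 - D ^ 2 = E at *
  generalize x * y - 4 = q at *
  have h6 : E * q ≤ 6 * D ^ 2 := by
    have : 0 ≤ E * (3 * q - 8 * E) := mul_nonneg hE0 (by linarith)
    linarith
  have h7 : (4 * D + 4) * (5 + 6 * D) ≤ E * q := by gcongr
  linarith [sq_nonneg D]

/-- Here `E = d ^ 2 - D ^ 2` is negative and `-E ≥ 2 * D` by parity, while `hs` bounds `-E * (x * y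
+ 4)` by `6 * D ^ 2`. So `x * y + 4 ≤ 3 * D`, against `x * y ≥ 3 * (x + y) - 9 = 6 * D - 9` and `D ≥
3`. -/
theorem opposite_branches_false {x y D d : ℤ} (hx : 3 ≤ x) (hy : 3 ≤ y) (hD : 0 ≤ D)
    (hd : 0 ≤ d) (hDe : Even D) (hde : Even d) (hxy : 4 * D ^ 2 = (x + y) ^ 2)
    (hrel : 4 * (d ^ 2 - D ^ 2) ^ 2 + 3 * (x * y + 4) * (d ^ 2 - D ^ 2) + 9 * D ^ 2 = 0)
    (hs : 0 < 3 * (x * y + 4) + 8 * (d ^ 2 - D ^ 2)) : False := by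
  have h2 : 2 * D = x + y :=
    (pow_left_inj₀ (by positivity) (by positivity) two_ne_zero).1 (by linarith : (2 * D) ^ 2 = _)
  have hDpos : 0 < D := by linarith
  have hD2 : 0 < D ^ 2 := by positivity
  have hq : 0 < x * y + 4 := by positivity
  have hneg : d ^ 2 - D ^ 2 < 0 := by
    by_contra hc
    push Not at hc
    have := mul_nonneg hq.le hc
    linarith [sq_nonneg (d ^ 2 - D ^ 2)]
  have hlt : d < D := (sq_lt_sq₀ hd hD).1 (by linarith)
  have hdl := add_two_le_of_even hde hDe hlt
  have hF : 2 * D ≤ -(d ^ 2 - D ^ 2) := by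
    have : 0 ≤ (D - 2 - d) * (D + d) := mul_nonneg (by linarith) (by linarith)
    linarith
  generalize d ^ 2 - D ^ 2 = E at *
  have h6 : -E * (x * y + 4) ≤ 6 * D ^ 2 := by
    have : 0 ≤ -E * (3 * (x * y + 4) + 8 * E) := mul_nonneg (by linarith) hs.le
    linarith
  have h7 : 2 * D * (x * y + 4) ≤ -E * (x * y + 4) := by gcongr
  have h8 : x * y + 4 ≤ 3 * D := le_of_mul_le_mul_left (by linarith) (by linarith : 0 < 2 * D)
  have h9 : 0 ≤ (x - 3) * (y - 3) := mul_nonneg (by linarith) (by linarith)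
  linarith

theorem three_le_abs_of_four_lt_sq {X : ℤ} (h : 4 < X ^ 2) : 3 ≤ |X| := by
  have : |2| < |X| := sq_lt_sq.1 (by linarith)
  exact this

/-- Two points of the hyperbola lying on the same pair of opposite arms coincide. -/
theorem eq_zero_of_hyperbola_relation {X Y d : ℤ} {K L : ℝ} (hX : Odd X) (hY : Odd Y)
    (hX2 : 4 < X ^ 2) (hY2 : 4 < Y ^ 2) (hd : 0 ≤ d)
    (hK : K ^ 2 = 3 * (X : ℝ) ^ 2 - 12) (hL : L ^ 2 = 3 * (Y : ℝ) ^ 2 - 12)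
    (hdist : 16 * (d : ℝ) ^ 2 = ((X : ℝ) - Y) ^ 2 + (K - L) ^ 2)
    (hs : 0 < (X * K) * (Y * L)) : d = 0 := by
  obtain ⟨δ, hδ⟩ : ∃ δ, X = Y + 2 * δ := by
    obtain ⟨a, rfl⟩ := hX
    obtain ⟨b, rfl⟩ := hY
    exact ⟨a - b, by ring⟩
  have hδR : (X : ℝ) = Y + 2 * δ := by exact_mod_cast hδ
  -- Expanding `hdist` isolates `K * L`. Squaring then removes the square roots but loses the sign
  -- of `K * L`, which `hsgn` retains.
  have hKL : K * L = 3 * ((X : ℝ) * Y - 4) - 8 * ((d : ℝ) ^ 2 - δ ^ 2) := by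
    have : (δ : ℝ) = (X - Y) / 2 := by linarith
    rw [this]
    linarith
  have hrelR : 4 * ((d : ℝ) ^ 2 - δ ^ 2) ^ 2 - 3 * ((X : ℝ) * Y - 4) * ((d : ℝ) ^ 2 - δ ^ 2)
      + 9 * (δ : ℝ) ^ 2 = 0 := by
    have e1 : (K * L) ^ 2 = (3 * (X : ℝ) ^ 2 - 12) * (3 * (Y : ℝ) ^ 2 - 12) := by
      rw [mul_pow, hK, hL]
    rw [hKL] at e1
    have : (δ : ℝ) ^ 2 = (X - Y) ^ 2 / 4 := by rw [hδR]; ring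
    generalize (d : ℝ) ^ 2 - δ ^ 2 = E at e1 ⊢
    rw [this]
    linarith
  have hrel : 4 * (d ^ 2 - δ ^ 2) ^ 2 - 3 * (X * Y - 4) * (d ^ 2 - δ ^ 2) + 9 * δ ^ 2 = 0 := by
    exact_mod_cast hrelR
  have hsgn : 0 < (X * Y) * (3 * (X * Y - 4) - 8 * (d ^ 2 - δ ^ 2)) := by
    have : 0 < ((X : ℝ) * Y) * (3 * ((X : ℝ) * Y - 4) - 8 * ((d : ℝ) ^ 2 - δ ^ 2)) := by
      rw [← hKL]; linarith
    exact_mod_cast this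
  obtain ⟨hδe, hde⟩ := even_of_hyperbola_relation hY hδ hrel
  have habs : δ ^ 2 = |δ| ^ 2 := (sq_abs δ).symm
  have hDe : Even |δ| := even_abs.2 hδe
  have hX3 := three_le_abs_of_four_lt_sq hX2
  have hY3 := three_le_abs_of_four_lt_sq hY2
  have hprod : |X * Y| = |X| * |Y| := abs_mul X Y
  have e : 4 * |δ| ^ 2 = |X| ^ 2 + |Y| ^ 2 - 2 * (X * Y) := by
    rw [sq_abs, sq_abs, sq_abs, hδ]; ring
  rw [habs] at hrel hsgn
  -- The sign of `X * Y` tells whether the points lie on one branch or on opposite ones.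
  rcases lt_trichotomy (X * Y) 0 with hp | hp | hp
  · have h1 := neg_of_mul_pos_right hsgn hp.le
    rw [abs_of_neg hp] at hprod
    have hp' : X * Y = -(|X| * |Y|) := by linarith
    rw [hp'] at hrel h1 e
    exact (opposite_branches_false hX3 hY3 (abs_nonneg δ) hd hDe hde (by linarith)
      (by linarith) (by linarith)).elim
  · rw [hp] at hsgn; simp at hsgn
  · have h1 := pos_of_mul_pos_right hsgn hp.le
    rw [abs_of_pos hp] at hprod
    rw [hprod] at hrel h1 e
    exact eq_zero_of_same_branch hX3 hY3 (abs_nonneg δ) hd hDe hde (by linarith) hrel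
      (by linarith)

/-- Two points of the perpendicular bisector at integral distances coincide. -/
theorem eq_zero_of_bisector_relation {a c d : ℤ} {K L : ℝ} (hL0 : L ≠ 0)
    (hK : K ^ 2 = 16 * (a : ℝ) ^ 2 - 16) (hL : L ^ 2 = 16 * (c : ℝ) ^ 2 - 16)
    (hdist : 16 * (d : ℝ) ^ 2 = (K - L) ^ 2) : d = 0 := by
  by_contra hd
  have hNR : ((a : ℝ) ^ 2 - c ^ 2 - d ^ 2) ^ 2 = (2 * d) ^ 2 * ((c : ℝ) ^ 2 - 1) := by
    have h1 : 8 * ((a : ℝ) ^ 2 - c ^ 2 - d ^ 2) = (K - L) * L := by linarith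
    have h2 : 64 * ((a : ℝ) ^ 2 - c ^ 2 - d ^ 2) ^ 2 = (K - L) ^ 2 * L ^ 2 := by
      rw [← mul_pow, ← h1]; ring
    rw [← hdist, hL] at h2
    linarith
  have hN : (a ^ 2 - c ^ 2 - d ^ 2) ^ 2 = (2 * d) ^ 2 * (c ^ 2 - 1) := by exact_mod_cast hNR
  -- If `d ≠ 0`, the height `L / 4` is rational with integral square, hence up to sign an integer
  -- `t`; but `c ^ 2 - t ^ 2 = 1` forces `t = 0`.
  obtain ⟨t, ht⟩ := (Int.pow_dvd_pow_iff two_ne_zero).1 (Dvd.intro _ hN.symm)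
  have hct : t ^ 2 = c ^ 2 - 1 := by
    rw [ht, mul_pow] at hN
    exact mul_left_cancel₀ (by positivity) hN
  have ht0 : t = 0 := by
    have h1 : |t| < |c| := sq_lt_sq.1 (by linarith)
    have h2 : |t| + 1 ≤ |c| := h1
    have : |t| = 0 := by nlinarith [sq_abs t, sq_abs c, abs_nonneg t]
    exact abs_eq_zero.1 this
  apply hL0
  have : (t : ℝ) ^ 2 = c ^ 2 - 1 := by exact_mod_cast hct
  rw [ht0] at this
  have : L ^ 2 = 0 := by rw [hL]; push_cast at this; linarith
  exact pow_eq_zero_iff (two_ne_zero) |>.1 this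

/-- Off the line `AB`, with `AB = 2`, a point at integral distances `a`, `b` from `A`, `B` lies on
the perpendicular bisector of `AB` or on the hyperbola `|a - b| = 1`. -/
theorem bisector_or_hyperbola {a b : ℤ} {K : ℝ} (ha : 0 ≤ a) (hb : 0 ≤ b) (hK0 : K ≠ 0)
    (hK : ((a : ℝ) ^ 2 - b ^ 2) ^ 2 + K ^ 2 = 8 * (a : ℝ) ^ 2 + 8 * (b : ℝ) ^ 2 - 16) :
    a = b ∨ (Odd (a ^ 2 - b ^ 2) ∧ 4 < (a ^ 2 - b ^ 2) ^ 2 ∧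
      K ^ 2 = 3 * ((a ^ 2 - b ^ 2 : ℤ) : ℝ) ^ 2 - 12) := by
  have hpos : 0 < K ^ 2 := by positivity
  -- Heron's formula: `K ^ 2` is minus this product.
  have hlt : ((a - b) ^ 2 - 4) * ((a + b) ^ 2 - 4) < 0 := by
    have : (((a : ℝ) - b) ^ 2 - 4) * (((a : ℝ) + b) ^ 2 - 4) < 0 := by nlinarith
    exact_mod_cast this
  have hle : (a - b) ^ 2 ≤ (a + b) ^ 2 := by nlinarith [mul_nonneg ha hb]
  have h1 : (a - b) ^ 2 < 4 := by
    by_contra hc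
    push Not at hc
    nlinarith
  have h2 : 4 < (a + b) ^ 2 := by
    by_contra hc
    push Not at hc
    nlinarith
  have h3 : -2 < a - b := by nlinarith
  have h4 : a - b < 2 := by nlinarith
  have hcase : a = b ∨ (a - b) ^ 2 = 1 := by
    have : a - b = 0 ∨ a - b = 1 ∨ a - b = -1 := by omega
    rcases this with h | h | h
    · left; omega
    · right; rw [h]; norm_num
    · right; rw [h]; norm_num
  refine hcase.imp_right fun h => ?_
  have hX2 : (a ^ 2 - b ^ 2) ^ 2 = (a + b) ^ 2 := by
    have : (a ^ 2 - b ^ 2) ^ 2 = (a - b) ^ 2 * (a + b) ^ 2 := by ring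
    rw [this, h, one_mul]
  refine ⟨?_, hX2 ▸ h2, ?_⟩
  · have hodd : Odd (a - b) := by
      by_contra hc
      rw [Int.not_odd_iff_even] at hc
      have : Even ((a - b) ^ 2) := hc.pow_of_ne_zero two_ne_zero
      rw [h] at this
      exact absurd this (by decide)
    have hodd2 : Odd (a + b) := by
      have : a + b = a - b + 2 * b := by ring
      rw [this]
      exact hodd.add_even (even_two_mul b)
    have : a ^ 2 - b ^ 2 = (a - b) * (a + b) := by ring
    rw [this]
    exact hodd.mul hodd2
  · have h' : ((a : ℝ) - b) ^ 2 = 1 := by exact_mod_cast h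
    have hX2' : ((a : ℝ) ^ 2 - b ^ 2) ^ 2 = (a + b) ^ 2 := by exact_mod_cast hX2
    push_cast
    linarith

/-- The signed distance of `C` from the line `AB`, times `2 |AB|`. -/
def signedHeight (A B C : EuclideanSpace ℝ (Fin 2)) : ℝ :=
  2 * ((B 0 - A 0) * (C 1 - A 1) - (B 1 - A 1) * (C 0 - A 0))

theorem dist_sq_eq_fin_two (A B : EuclideanSpace ℝ (Fin 2)) :
    dist A B ^ 2 = (A 0 - B 0) ^ 2 + (A 1 - B 1) ^ 2 := by
  rw [EuclideanSpace.dist_eq, Real.sq_sqrt (by positivity)]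
  simp [Fin.sum_univ_two, Real.dist_eq, sq_abs]

theorem collinear_of_signedHeight_eq_zero {A B C : EuclideanSpace ℝ (Fin 2)}
    (hAB : dist A B = 2) (h : signedHeight A B C = 0) : Collinear ℝ {A, B, C} := by
  have h4 := dist_sq_eq_fin_two A B
  rw [hAB] at h4
  unfold signedHeight at h
  rw [collinear_iff_of_mem (p₀ := A) (by simp)]
  refine ⟨B - A, ?_⟩
  simp only [Set.mem_insert_iff, Set.mem_singleton_iff, forall_eq_or_imp, forall_eq]
  refine ⟨⟨0, by simp⟩, ⟨1, by simp⟩,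
    ⟨((B 0 - A 0) * (C 0 - A 0) + (B 1 - A 1) * (C 1 - A 1)) / 4, ?_⟩⟩
  ext i
  fin_cases i
  · simp
    linear_combination (C 0 - A 0) / 4 * h4 - (B 1 - A 1) / 8 * h
  · simp
    linear_combination (C 1 - A 1) / 4 * h4 + (B 0 - A 0) / 8 * h

theorem sq_add_signedHeight_sq {A B C : EuclideanSpace ℝ (Fin 2)} (hAB : dist A B = 2) :
    (dist C A ^ 2 - dist C B ^ 2) ^ 2 + signedHeight A B C ^ 2 =
      8 * dist C A ^ 2 + 8 * dist C B ^ 2 - 16 := by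
  have h4 := dist_sq_eq_fin_two A B
  rw [hAB] at h4
  simp only [dist_sq_eq_fin_two, signedHeight]
  linear_combination
    -(4 * ((C 0 - A 0) ^ 2 + (C 1 - A 1) ^ 2)
      - 4 * ((B 0 - A 0) * (C 0 - A 0) + (B 1 - A 1) * (C 1 - A 1))
      + (A 0 - B 0) ^ 2 + (A 1 - B 1) ^ 2 - 4) * h4

/-- With the origin at the midpoint of `AB` and the first axis along `AB`, the difference of squared
distances and `signedHeight` are four times the Cartesian coordinates. -/
theorem sixteen_mul_dist_sq {A B C D : EuclideanSpace ℝ (Fin 2)} (hAB : dist A B = 2) :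
    16 * dist C D ^ 2 =
      ((dist C A ^ 2 - dist C B ^ 2) - (dist D A ^ 2 - dist D B ^ 2)) ^ 2 +
        (signedHeight A B C - signedHeight A B D) ^ 2 := by
  have h4 := dist_sq_eq_fin_two A B
  rw [hAB] at h4
  simp only [dist_sq_eq_fin_two, signedHeight]
  linear_combination 4 * ((C 0 - D 0) ^ 2 + (C 1 - D 1) ^ 2) * h4

/-- A Diophantine polygon with a side or diagonal of length two has at most five vertices. -/
theorem Polygon.IsDiophantine.le_five {n : ℕ} {P : Polygon (EuclideanSpace ℝ (Fin 2)) n}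
    (hP : P.IsDiophantine) (h2 : ∃ i j : Fin n, dist (P i) (P j) = 2) : n ≤ 5 := by
  obtain ⟨i, j, hij⟩ := h2
  have hne : i ≠ j := by
    rintro rfl
    simp at hij
  have hdist : ∀ k l : Fin n, ∃ m : ℤ, 0 ≤ m ∧ dist (P k) (P l) = m := fun k l => by
    obtain ⟨m, hm⟩ := hP.dist_nat k l
    exact ⟨m, by positivity, by simpa using hm⟩
  choose r hr0 hr using hdist
  let K : Fin n → ℝ := fun k => signedHeight (P i) (P j) (P k)
  have hK0 : ∀ k, k ≠ i → k ≠ j → K k ≠ 0 := fun k hki hkj h =>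
    hP.not_collinear i j k hne hkj.symm hki.symm (collinear_of_signedHeight_eq_zero hij h)
  have hcase : ∀ k, k ≠ i → k ≠ j → _ := fun k hki hkj =>
    bisector_or_hyperbola (a := r k i) (b := r k j) (hr0 k i) (hr0 k j) (hK0 k hki hkj) (by
      rw [← hr, ← hr]
      exact sq_add_signedHeight_sq hij)
  let X : Fin n → ℤ := fun k => r k i ^ 2 - r k j ^ 2
  have hd : ∀ k l, 16 * (r k l : ℝ) ^ 2 = ((X k : ℝ) - X l) ^ 2 + (K k - K l) ^ 2 := by
    intro k l
    have := sixteen_mul_dist_sq (C := P k) (D := P l) hij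
    simp only [hr] at this
    simpa [X, K] using this
  have heq : ∀ k l, r k l = 0 → k = l := by
    intro k l h
    apply hP.isSimple.1
    have := hr k l
    rw [h, Int.cast_zero] at this
    exact dist_eq_zero.1 this
  -- The value 0 marks the bisector, and 1 and -1 the two pairs of opposite arms.
  let f : Fin n → SignType := fun k => SignType.sign ((X k : ℝ) * K k)
  have hinj : Set.InjOn f ((Finset.univ.erase i).erase j : Finset (Fin n)) := by
    intro k hk l hl hkl
    simp only [Finset.coe_erase, Finset.coe_univ, Set.mem_sdiff, Set.mem_univ, true_and,
      Set.mem_singleton_iff] at hk hl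
    apply heq
    have hXK : ∀ k, K k ≠ 0 → X k ≠ 0 → f k ≠ 0 := fun k h1 h2 h3 => by
      rw [sign_eq_zero_iff] at h3
      exact mul_ne_zero (by exact_mod_cast h2) h1 h3
    have hXne : ∀ k, 4 < X k ^ 2 → X k ≠ 0 := fun k h1 h2 => by
      rw [h2] at h1; norm_num at h1
    have hX0 : ∀ k, r k i = r k j → X k = 0 := fun k h => by simp [X, h]
    have hf0 : ∀ k, r k i = r k j → f k = 0 := fun k h => by simp [f, hX0 k h]
    rcases hcase k hk.1 hk.2 with hbk | ⟨ok, sk, ek⟩ <;>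
      rcases hcase l hl.1 hl.2 with hbl | ⟨ol, sl, el⟩
    · have hbis : ∀ k, r k i = r k j → K k ^ 2 = 16 * (r k i : ℝ) ^ 2 - 16 := by
        intro k h
        have := sq_add_signedHeight_sq (C := P k) hij
        rw [hr, hr, ← h] at this
        simp only [K]
        linarith
      refine eq_zero_of_bisector_relation (hK0 l hl.1 hl.2) (hbis k hbk) (hbis l hbl) ?_
      rw [hd, hX0 k hbk, hX0 l hbl]
      simp
    · exact absurd (hkl ▸ hf0 k hbk) (hXK l (hK0 l hl.1 hl.2) (hXne l sl))
    · exact absurd (hkl.trans (hf0 l hbl)) (hXK k (hK0 k hk.1 hk.2) (hXne k sk))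
    · refine eq_zero_of_hyperbola_relation ok ol sk sl (hr0 k l) ek el (hd k l) ?_
      have h0 := hXK k (hK0 k hk.1 hk.2) (hXne k sk)
      have h1 : SignType.sign (((X k : ℝ) * K k) * ((X l : ℝ) * K l)) = 1 := by
        rw [sign_mul]
        change f k * f l = 1
        rw [← hkl]
        revert h0
        generalize f k = s
        revert s
        decide
      exact sign_eq_one_iff.1 h1
  have hcard := Finset.card_le_card_of_injOn f (fun _ _ => Finset.mem_univ _) hinj
  rw [Finset.card_erase_of_mem (by simp [hne.symm]), Finset.card_erase_of_mem (by simp),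
    Finset.card_univ, Finset.card_univ, Fintype.card_fin] at hcard
  have : Fintype.card SignType = 3 := rfl
  omega

theorem mainTheorem3 {n : ℕ} (P : Polygon (EuclideanSpace ℝ (Fin 2)) n)
    (hP : P.IsDiophantine) (h2 : ∃ i j : Fin n, dist (P i) (P j) = 2) :
    (P.IsConvex → n ≤ 5) ∧ (P.IsConcave → n ≤ 6) :=
  ⟨fun _ => hP.le_five h2, fun _ => (hP.le_five h2).trans (by norm_num)⟩
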